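/- **Theorem (characterization of CETCS).** Let $\mathcal C$ be a category. *Conventions.* If $\mathcal C$ has a terminal object $1$, an *element* of $A$ is a map $1\to A$, written $x\in A$. For maps $m_k\colon M\to X_k$ and elements $x_k\in X_k$, the tuple $(x_1,\dots,x_n)$ is a *member* of $(m_1,\dots,m_n)$ if there is $a\in M$ with $m_k a=x_k$ for all $k$. A map $f\colon A\to B$ is *onto* if for every $y\in B$ there is $x\in A$ with $fx=y$. An object $P$ is a *choice object* if every onto map $A\to P$ has a section. A *cover* is a map $f$ such that whenever $f=mg$ with $m$ mono, $m$ is an isomorphism. An object $P$ is *projective* if every map $P\to B$ lifts along every cover $A\to B$. A *$\Pi$-diagram* for $Y\xrightarrow{g}X\xrightarrow{f}I$ consists of a pullback square $P\xrightarrow{\pi_1}F$, $P\xrightarrow{\pi_2}X$, $F\xrightarrow{\varphi}I$, $X\xrightarrow{f}I$ together with a map $\mathrm{ev}\colon P\to Y$ such that $g\,\mathrm{ev}=\pi_2$. An *equivalence relation* is an internal one: a jointly monic pair $r_1,r_2\colon R\to X$ that is reflexive, symmetric and transitive. *CETCS.* $\mathcal C$ *satisfies CETCS* if the following axioms hold.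 - (C1–C3) $\mathcal C$ has a terminal object, binary products and equalizers. - (D1–D3) $\mathcal C$ has an initial object $0$, binary sums and coequalizers. - ($\Pi$) Every $Y\xrightarrow{g}X\xrightarrow{f}I$ has a $\Pi$-diagram with the following property. Let $i\in I$, and let $\xi\colon R\to X$, $\upsilon\colon R\to Y$ be maps with $\xi$ mono such that (a) whenever $(x,y)$ is a member of $(\xi,\upsilon)$, then $gy=x$ and $fx=i$, and (b) for every $x\in X$ with $fx=i$ there is $y\in Y$ such that $(x,y)$ is a member of $(\xi,\upsilon)$. Then there is a unique $s\in F$ such that $\varphi s=i$ and, for all $x\in X$ and $y\in Y$, $(s,x,y)$ is a member of $(\pi_1,\pi_2,\mathrm{ev})$ if and only if $(x,y)$ is a member of $(\xi,\upsilon)$. - (NNO) There is a natural numbers object: maps $1\xrightarrow{0}N\xrightarrow{S}N$ such that for all $1\xrightarrow{b}A\xrightarrow{h}A$ there is a unique $f\colon N\to A$ with $f0=b$ and $fS=hf$. - (G) Every map that is both onto and mono is an isomorphism. - (PA) For every object $A$ there is an onto map $P\to A$ with $P$ a choice object. - (I) $0$ has no elements. - (DP) For every sum diagram $A\xrightarrow{i}S\xleftarrow{j}B$,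 each $z\in S$ is a member of $i$ or of $j$. - (NT) For every sum diagram $1\xrightarrow{x}S\xleftarrow{y}1$, $x\neq y$. - (Fct) Every map $f$ factors as $f=ie$ with $i$ mono and $e$ onto. - (Eff) For every equivalence relation $r_1,r_2\colon R\to X$ there is a map $e\colon X\to E$ such that, for all $x_1,x_2\in X$, $(x_1,x_2)$ is a member of $(r_1,r_2)$ if and only if $ex_1=ex_2$. *Statement.* $\mathcal C$ satisfies CETCS if, and only if, it has the following seven properties: 1. it is locally cartesian closed: it has finite limits, and every $Y\xrightarrow{g}X\xrightarrow{f}I$ has a universal $\Pi$-diagram, that is, a terminal object in the category of its $\Pi$-diagrams (a morphism from $(P',F',\pi_1',\pi_2',\varphi',\mathrm{ev}')$ to $(P,F,\pi_1,\pi_2,\varphi,\mathrm{ev})$ is a map $n\colon F'\to F$ with $\varphi n=\varphi'$ such that the induced map $m\colon P'\to P$, given by $\pi_1m=n\pi_1'$ and $\pi_2m=\pi_2'$, satisfies $\mathrm{ev}\,m=\mathrm{ev}'$); 2. it is a pretopos: it is regular (finite limits and image factorizations exist, and covers are stable under pullback), every equivalence relation is effective (the kernel pair of some map), and it is finitary extensive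 (finite sums exist and are disjoint and stable under pullback); 3. it has a natural numbers object; 4. its terminal object $1$ is projective and generates $\mathcal C$, i.e. every map that is both onto and mono is an isomorphism; 5. $0\not\cong 1$; 6. it satisfies the disjunction property (DP); 7. it has enough projectives: for every object $A$ there is a cover $P\to A$ with $P$ projective. -/

import Mathlib

open CategoryTheory CategoryTheory.Limits

universe v u

namespace ConstructiveSets

section General

variable {C : Type u} [Category.{v} C]

/-! ### Dependent product diagrams and local cartesian closure -/

/-- A `Π`-diagram for `Y ⟶ X ⟶ I`: a commutative diagram whose right-hand square is a pullback.
```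
      ev        π₁
  Y <----- P ------> F
    \      |         |
   g \     | π₂      | φ
      v    v         v
           X ------> I
                f
```
-/
structure PiDiagram {Y X I : C} (g : Y ⟶ X) (f : X ⟶ I) where
  /-- the parameter object -/
  F : C
  P : C
  φ : F ⟶ I
  π₁ : P ⟶ F
  π₂ : P ⟶ X
  ev : P ⟶ Y
  isPullback : IsPullback π₁ π₂ φ f
  ev_comp : ev ≫ g = π₂

/-- A `Π`-diagram is universal if every other `Π`-diagram `D'` over the same pair of maps has
exactly one morphism `n` of `Π`-diagrams to it: a map of parameter objects over `I` for which the
induced map `m` of the pullback objects commutes with the evaluation maps. -/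
def PiDiagram.IsUniversal {Y X I : C} {g : Y ⟶ X} {f : X ⟶ I} (D : PiDiagram g f) : Prop :=
  ∀ D' : PiDiagram g f, ∃! n : D'.F ⟶ D.F, n ≫ D.φ = D'.φ ∧
    ∃ m : D'.P ⟶ D.P, m ≫ D.π₁ = D'.π₁ ≫ n ∧ m ≫ D.π₂ = D'.π₂ ∧ m ≫ D.ev = D'.ev

/-! ### Images, covers, projective objects -/

/-- `e` followed by the mono `m` is an image factorization of `f`. -/
def IsImageFactorization {A I B : C} (f : A ⟶ B) (e : A ⟶ I) (m : I ⟶ B) : Prop :=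
  Mono m ∧ e ≫ m = f ∧
    ∀ ⦃I' : C⦄ (e' : A ⟶ I') (m' : I' ⟶ B), Mono m' → e' ≫ m' = f → ∃ t : I ⟶ I', t ≫ m' = m

/-- A cover is a map that factors through no proper subobject of its codomain. -/
def IsCover {A B : C} (f : A ⟶ B) : Prop :=
  ∀ ⦃M : C⦄ (g : A ⟶ M) (m : M ⟶ B), Mono m → g ≫ m = f → IsIso m

/-- Projectivity (with respect to covers, which in a pretopos are the same as the epimorphisms). -/
def IsProjective (P : C) : Prop :=
  ∀ ⦃A B : C⦄ (e : A ⟶ B), IsCover e → ∀ h : P ⟶ B, ∃ k : P ⟶ A, k ≫ e = h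

variable (C)

/-- Every object is covered by a projective object. -/
def HasEnoughProjectives : Prop :=
  ∀ A : C, ∃ (P : C) (p : P ⟶ A), IsProjective P ∧ IsCover p

/-- Locally cartesian closed categories: finite limits and all dependent products exist. -/
class LocallyCartesianClosed : Prop extends HasFiniteLimits C where
  exists_universal : ∀ ⦃Y X I : C⦄ (g : Y ⟶ X) (f : X ⟶ I), ∃ D : PiDiagram g f, D.IsUniversal

/-- Regular categories: finite limits and image factorizations exist, and covers are stable under
pullback. -/
class RegularCategory : Prop extends HasFiniteLimits C where
  exists_image : ∀ ⦃A B : C⦄ (f : A ⟶ B),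
    ∃ (I : C) (e : A ⟶ I) (m : I ⟶ B), IsImageFactorization f e m
  cover_of_isPullback : ∀ ⦃P A B D : C⦄ (p : P ⟶ A) (q : P ⟶ B) (f : A ⟶ D) (g : B ⟶ D),
    IsPullback p q f g → IsCover g → IsCover p

/-- Pretoposes: regular categories in which every equivalence relation is effective (the kernel
pair of some map) and which have finite sums that are disjoint and stable under pullback. -/
class Pretopos : Prop extends RegularCategory C, FinitaryExtensive C where
  effective : ∀ ⦃R X : C⦄ (r₁ r₂ : R ⟶ X), IsEquivalenceRelation r₁ r₂ →
    ∃ (E : C) (e : X ⟶ E), IsKernelPair e r₁ r₂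

end General

section Elements

variable {C : Type u} [Category.{v} C] [HasTerminal C]

/-- The elements of an object. -/
abbrev Element (A : C) := ⊤_ C ⟶ A

/-- `x` is a member of `m`. -/
def Mem {M X : C} (x : Element X) (m : M ⟶ X) : Prop :=
  ∃ a : Element M, a ≫ m = x

/-- `(x₁, x₂)` is a member of `(m₁, m₂)`. -/
def Mem₂ {M X₁ X₂ : C} (x₁ : Element X₁) (x₂ : Element X₂) (m₁ : M ⟶ X₁) (m₂ : M ⟶ X₂) : Prop :=
  ∃ a : Element M, a ≫ m₁ = x₁ ∧ a ≫ m₂ = x₂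

/-- `(x₁, x₂, x₃)` is a member of `(m₁, m₂, m₃)`. -/
def Mem₃ {M X₁ X₂ X₃ : C} (x₁ : Element X₁) (x₂ : Element X₂) (x₃ : Element X₃)
    (m₁ : M ⟶ X₁) (m₂ : M ⟶ X₂) (m₃ : M ⟶ X₃) : Prop :=
  ∃ a : Element M, a ≫ m₁ = x₁ ∧ a ≫ m₂ = x₂ ∧ a ≫ m₃ = x₃

/-- A map is onto if it is surjective on elements. -/
def Onto {A B : C} (f : A ⟶ B) : Prop :=
  ∀ y : Element B, ∃ x : Element A, x ≫ f = y

/-- Choice objects: every map onto `P` has a section. -/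
def IsChoiceObject (P : C) : Prop :=
  ∀ ⦃A : C⦄ (f : A ⟶ P), Onto f → ∃ g : P ⟶ A, g ≫ f = 𝟙 P

/-- The elementwise universal property of a `Π`-diagram: for each `i ∈ I` and each partial function
`ψ = (ξ, υ) : R ⟶ (X, Y)` such that (a) `ψ(x) = y` implies `g y = x` and `f x = i`, and (b) `ψ(x)`
is defined whenever `f x = i`, there is a unique `s ∈ F` over `i` whose graph is `ψ`. -/
def PiDiagram.IsUniversalOnElements {Y X I : C} {g : Y ⟶ X} {f : X ⟶ I} (D : PiDiagram g f) :
    Prop :=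
  ∀ (i : Element I) ⦃R : C⦄ (ξ : R ⟶ X) (υ : R ⟶ Y), Mono ξ →
    (∀ (x : Element X) (y : Element Y), Mem₂ x y ξ υ → y ≫ g = x ∧ x ≫ f = i) →
    (∀ x : Element X, x ≫ f = i → ∃ y : Element Y, Mem₂ x y ξ υ) →
    ∃! s : Element D.F, s ≫ D.φ = i ∧
      ∀ (x : Element X) (y : Element Y), Mem₃ s x y D.π₁ D.π₂ D.ev ↔ Mem₂ x y ξ υ

variable (C)

/-- There is a natural numbers object. -/
def HasNNO : Prop :=
  ∃ (N : C) (zero : ⊤_ C ⟶ N) (succ : N ⟶ N), ∀ ⦃A : C⦄ (b : ⊤_ C ⟶ A) (h : A ⟶ A),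
    ∃! f : N ⟶ A, zero ≫ f = b ∧ succ ≫ f = f ≫ h

/-- The terminal object generates the category: a mono that is onto is an isomorphism. -/
def TerminalGenerates : Prop :=
  ∀ ⦃A B : C⦄ (f : A ⟶ B), Onto f → Mono f → IsIso f

/-- The disjunction property: each element of a sum is a member of one of the injections. -/
def DisjunctionProperty : Prop :=
  ∀ ⦃A B S : C⦄ (i : A ⟶ S) (j : B ⟶ S), Nonempty (IsColimit (BinaryCofan.mk i j)) →
    ∀ z : Element S, Mem z i ∨ Mem z j

end Elements

/-- The axioms of the constructive elementary theory of the category of sets. -/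
structure CETCS (C : Type u) [Category.{v} C] : Prop where
  [hasTerminal : HasTerminal C]
  [hasBinaryProducts : HasBinaryProducts C]
  [hasEqualizers : HasEqualizers C]
  [hasInitial : HasInitial C]
  [hasBinaryCoproducts : HasBinaryCoproducts C]
  [hasCoequalizers : HasCoequalizers C]
  dependentProducts : ∀ ⦃Y X I : C⦄ (g : Y ⟶ X) (f : X ⟶ I),
    ∃ D : PiDiagram g f, D.IsUniversalOnElements
  naturalNumbers : HasNNO C
  generation : TerminalGenerates C
  presentation : ∀ A : C, ∃ (P : C) (p : P ⟶ A), IsChoiceObject P ∧ Onto p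
  initial_no_elements : IsEmpty (Element (⊥_ C))
  disjunction : DisjunctionProperty C
  nontriviality : ∀ ⦃S : C⦄ (x y : Element S),
    Nonempty (IsColimit (BinaryCofan.mk x y)) → x ≠ y
  factorization : ∀ ⦃A B : C⦄ (f : A ⟶ B),
    ∃ (I : C) (e : A ⟶ I) (i : I ⟶ B), Onto e ∧ Mono i ∧ e ≫ i = f
  effectiveness : ∀ ⦃R X : C⦄ (r₁ r₂ : R ⟶ X), IsEquivalenceRelation r₁ r₂ →
    ∃ (E : C) (e : X ⟶ E), ∀ x₁ x₂ : Element X, Mem₂ x₁ x₂ r₁ r₂ ↔ x₁ ≫ e = x₂ ≫ e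

end ConstructiveSets

open ConstructiveSets

/-! When maps factor as onto followed by mono and the terminal object generates, a finitely complete
category behaves like a category of sets: equalities, isomorphisms, pullbacks and lifts through
monos can be tested on elements, and covers are exactly the onto maps (`isCover_iff_onto`). Both
sides of the equivalence supply this setting. CETCS assumes it; in a regular category whose terminal
object is projective, the cover part of an image factorization is onto.

The remaining difficulty is to build maps from elementwise data. Sets of elements cut out by monos
are closed under preimage, image, conjunction and, given dependent products, universal
quantification and implication; a definable functional relation is the graph of a map
(`Definable.exists_hom`). Compatibility of parameters is such a relation between two `Π`-diagrams,
so elementwise universality yields genuine universality. Conversely, a partial function as in (Π) is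
itself a `Π`-diagram with parameter object `1`.

The disjunction property and nontriviality make sums van Kampen, hence extensive. Coequalizers,
which are not among the seven properties, come from the natural numbers object: chains of steps
indexed by it generate a definable equivalence relation, whose effective quotient is cut down to an
image. -/

namespace ConstructiveSets

attribute [local simp] prod.lift_fst prod.lift_snd prod.lift_fst_assoc prod.lift_snd_assoc
  pullback.lift_fst pullback.lift_snd pullback.lift_fst_assoc pullback.lift_snd_assoc
  coprod.inl_desc coprod.inr_desc coprod.inl_desc_assoc coprod.inr_desc_assoc

/-! ### Elementwise reasoning and definable sets of elements -/

section WellPointed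

/-- Finitely complete categories generated by the terminal object in which every map is an onto map
followed by a mono. -/
class WellPointedRegular (C : Type u) [Category.{v} C] [HasFiniteLimits C] : Prop where
  generation : TerminalGenerates C
  factorization : ∀ ⦃A B : C⦄ (f : A ⟶ B),
    ∃ (I : C) (e : A ⟶ I) (i : I ⟶ B), Onto e ∧ Mono i ∧ e ≫ i = f

variable {C : Type u} [Category.{v} C] [HasFiniteLimits C]

@[simp]
theorem terminal_from_self_comp {A : C} (x : Element A) : terminal.from (⊤_ C) ≫ x = x := by
  rw [Subsingleton.elim (terminal.from (⊤_ C)) (𝟙 _), Category.id_comp]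

/-- A set of elements is definable if it consists of the members of a mono. -/
def Definable {X : C} (S : Set (Element X)) : Prop :=
  ∃ (M : C) (m : M ⟶ X), Mono m ∧ ∀ x, x ∈ S ↔ Mem x m

theorem Definable.congr {X : C} {S T : Set (Element X)} (hS : Definable S)
    (h : ∀ x, x ∈ S ↔ x ∈ T) : Definable T := by
  obtain ⟨M, m, hm, hM⟩ := hS
  exact ⟨M, m, hm, fun x => (h x).symm.trans (hM x)⟩

theorem Definable.preimage {X Y : C} {S : Set (Element Y)} (hS : Definable S) (f : X ⟶ Y) :
    Definable {x : Element X | x ≫ f ∈ S} := by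
  obtain ⟨M, m, hm, h⟩ := hS
  refine ⟨_, pullback.snd m f, inferInstance, fun x => ?_⟩
  rw [Set.mem_ofPred_eq, h]
  constructor
  · rintro ⟨a, ha⟩
    exact ⟨pullback.lift a x ha, by simp⟩
  · rintro ⟨a, rfl⟩
    exact ⟨a ≫ pullback.fst m f, by simp [pullback.condition]⟩

theorem definable_eq {X Y : C} (f g : X ⟶ Y) :
    Definable {x : Element X | x ≫ f = x ≫ g} := by
  refine ⟨_, equalizer.ι f g, inferInstance, fun x => ?_⟩
  constructor
  · exact fun h => ⟨equalizer.lift x h, by simp⟩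
  · rintro ⟨a, rfl⟩
    rw [Set.mem_ofPred_eq, Category.assoc, Category.assoc, equalizer.condition]

variable [WellPointedRegular C]

/-! ### Testing properties of maps on elements -/

theorem isIso_of_onto_of_mono {A B : C} {f : A ⟶ B} (hf : Onto f) (hm : Mono f) : IsIso f :=
  WellPointedRegular.generation f hf hm

/-- Every element factors through the equalizer of `f` and `g`, so that mono is onto, hence
invertible by generation. -/
theorem element_ext {A B : C} {f g : A ⟶ B} (h : ∀ x : Element A, x ≫ f = x ≫ g) : f = g := by
  have : IsIso (equalizer.ι f g) := isIso_of_onto_of_mono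
    (fun y => ⟨equalizer.lift y (h y), by simp⟩) inferInstance
  rw [← cancel_epi (equalizer.ι f g)]
  exact equalizer.condition f g

theorem mono_of_injective {A B : C} {f : A ⟶ B}
    (h : ∀ x y : Element A, x ≫ f = y ≫ f → x = y) : Mono f :=
  ⟨fun u w huw => element_ext fun x => h _ _ (by simp [huw])⟩

theorem isIso_of_bijective {A B : C} {f : A ⟶ B} (hf : Onto f)
    (h : ∀ x y : Element A, x ≫ f = y ≫ f → x = y) : IsIso f :=
  isIso_of_onto_of_mono hf (mono_of_injective h)

/-- The pullback of `m` along `f` is a mono and, by `h`, onto; its inverse provides the lift. -/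
theorem exists_lift_of_mem {A B M : C} {m : M ⟶ B} (hm : Mono m) {f : A ⟶ B}
    (h : ∀ x : Element A, Mem (x ≫ f) m) : ∃ k : A ⟶ M, k ≫ m = f := by
  have : IsIso (pullback.snd m f) := isIso_of_onto_of_mono (fun y => by
    obtain ⟨a, ha⟩ := h y
    exact ⟨pullback.lift a y ha, by simp⟩) inferInstance
  refine ⟨inv (pullback.snd m f) ≫ pullback.fst m f, ?_⟩
  rw [Category.assoc, pullback.condition, IsIso.inv_hom_id_assoc]

theorem isPullback_of_elements {P A B D : C} {p : P ⟶ A} {q : P ⟶ B} {f : A ⟶ D} {g : B ⟶ D}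
    (w : p ≫ f = q ≫ g)
    (inj : ∀ z z' : Element P, z ≫ p = z' ≫ p → z ≫ q = z' ≫ q → z = z')
    (surj : ∀ (x : Element A) (y : Element B), x ≫ f = y ≫ g →
      ∃ z : Element P, z ≫ p = x ∧ z ≫ q = y) :
    IsPullback p q f g := by
  have : IsIso (pullback.lift p q w) := isIso_of_bijective
    (fun y => by
      obtain ⟨z, hp, hq⟩ := surj (y ≫ pullback.fst f g) (y ≫ pullback.snd f g)
        (by simp [pullback.condition])
      exact ⟨z, pullback.hom_ext (by simp [hp]) (by simp [hq])⟩)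
    (fun z z' h => inj z z'
      (by simpa using congr($h ≫ pullback.fst f g)) (by simpa using congr($h ≫ pullback.snd f g)))
  exact IsPullback.of_iso_pullback ⟨w⟩ (asIso (pullback.lift p q w)) (by simp) (by simp)

/-- The mono part of the factorization of a cover is invertible, which leaves the onto part.
Conversely, if `g ≫ m` is onto then so is `m`, and generation applies. -/
theorem isCover_iff_onto {A B : C} (f : A ⟶ B) : IsCover f ↔ Onto f := by
  constructor
  · intro hf
    obtain ⟨I, e, i, he, hi, rfl⟩ := WellPointedRegular.factorization f
    have := hf e i hi rfl
    intro y
    obtain ⟨x, hx⟩ := he (y ≫ inv i)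
    exact ⟨x, by simp [reassoc_of% hx]⟩
  · rintro hf M g m hm rfl
    refine isIso_of_onto_of_mono (fun y => ?_) hm
    obtain ⟨x, hx⟩ := hf y
    exact ⟨x ≫ g, by simpa using hx⟩

/-- The image of `(e, h)` in `B ⨯ D` is the graph of the desired map: its projection to `B` is onto
because `e` is, and injective by `hh`. -/
theorem exists_factorization_of_onto {A B D : C} {e : A ⟶ B} (he : Onto e) (h : A ⟶ D)
    (hh : ∀ x y : Element A, x ≫ e = y ≫ e → x ≫ h = y ≫ h) : ∃ k : B ⟶ D, e ≫ k = h := by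
  obtain ⟨I, c, i, hc, hi, hci⟩ := WellPointedRegular.factorization (prod.lift e h)
  have hfst : c ≫ i ≫ prod.fst = e := by simp [reassoc_of% hci]
  have hsnd : c ≫ i ≫ prod.snd = h := by simp [reassoc_of% hci]
  have : IsIso (i ≫ prod.fst) := isIso_of_bijective
    (fun y => by
      obtain ⟨x, rfl⟩ := he y
      exact ⟨x ≫ c, by rw [Category.assoc, hfst]⟩)
    (fun y y' hy => by
      obtain ⟨x, rfl⟩ := hc y
      obtain ⟨x', rfl⟩ := hc y'
      rw [Category.assoc, Category.assoc, hfst] at hy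
      rw [← cancel_mono i]
      apply Limits.prod.hom_ext
      · simpa [hfst] using hy
      · simpa [hsnd] using hh x x' hy)
  refine ⟨inv (i ≫ prod.fst) ≫ i ≫ prod.snd, ?_⟩
  conv_lhs => rw [← hfst]
  rw [← hsnd]
  have := congr(c ≫ $(IsIso.hom_inv_id_assoc (i ≫ prod.fst) (i ≫ prod.snd)))
  simpa only [Category.assoc] using this

/-! ### Closure properties of definable sets -/

theorem definable_range {X Y : C} (f : X ⟶ Y) : Definable {y : Element Y | Mem y f} := by
  obtain ⟨I, e, i, he, hi, rfl⟩ := WellPointedRegular.factorization f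
  refine ⟨I, i, hi, fun y => ?_⟩
  constructor
  · rintro ⟨a, rfl⟩
    exact ⟨a ≫ e, by simp⟩
  · rintro ⟨a, rfl⟩
    obtain ⟨b, rfl⟩ := he a
    exact ⟨b, by simp⟩

theorem Definable.image {X Y : C} {S : Set (Element X)} (hS : Definable S) (f : X ⟶ Y) :
    Definable {y : Element Y | ∃ x ∈ S, x ≫ f = y} := by
  obtain ⟨M, m, hm, h⟩ := hS
  obtain ⟨I, i, hi, hI⟩ := definable_range (m ≫ f)
  refine ⟨I, i, hi, fun y => ?_⟩
  rw [← hI]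
  constructor
  · rintro ⟨x, hx, rfl⟩
    obtain ⟨a, rfl⟩ := (h x).1 hx
    exact ⟨a, by simp⟩
  · rintro ⟨a, rfl⟩
    exact ⟨a ≫ m, (h _).2 ⟨a, rfl⟩, by simp⟩

theorem Definable.inter {X : C} {S T : Set (Element X)} (hS : Definable S) (hT : Definable T) :
    Definable {x : Element X | x ∈ S ∧ x ∈ T} := by
  obtain ⟨M, m, hm, h⟩ := hS
  have := (hT.preimage m).image m
  obtain ⟨I, i, hi, hI⟩ := this
  refine ⟨I, i, hi, fun y => ?_⟩
  rw [← hI]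
  constructor
  · rintro ⟨hx, hx'⟩
    obtain ⟨a, rfl⟩ := (h y).1 hx
    exact ⟨a, hx', rfl⟩
  · rintro ⟨a, ha, rfl⟩
    exact ⟨(h _).2 ⟨a, rfl⟩, ha⟩

/-- The mono defining `r` is a graph: unique existence makes its projection to `A` bijective on
elements, hence invertible. -/
theorem Definable.exists_hom {A B : C} {r : Element A → Element B → Prop}
    (hr : Definable {z : Element (A ⨯ B) | r (z ≫ prod.fst) (z ≫ prod.snd)})
    (h : ∀ a, ∃! b, r a b) : ∃ f : A ⟶ B, ∀ a, r a (a ≫ f) := by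
  obtain ⟨M, m, hm, hM⟩ := hr
  have : IsIso (m ≫ prod.fst) := isIso_of_bijective
    (fun a => by
      obtain ⟨b, hb, -⟩ := h a
      obtain ⟨c, hc⟩ := (hM (prod.lift a b)).1 (by simpa using hb)
      exact ⟨c, by simp [reassoc_of% hc]⟩)
    (fun x y hxy => by
      have hx := (hM (x ≫ m)).2 ⟨x, rfl⟩
      have hy := (hM (y ≫ m)).2 ⟨y, rfl⟩
      simp only [Category.assoc, Set.mem_ofPred_eq] at hx hy hxy
      rw [← hxy] at hy
      rw [← cancel_mono m]
      apply Limits.prod.hom_ext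
      · simpa using hxy
      · simpa using (h _).unique hx hy)
  refine ⟨inv (m ≫ prod.fst) ≫ m ≫ prod.snd, fun a => ?_⟩
  have ha := (hM ((a ≫ inv (m ≫ prod.fst)) ≫ m)).2 ⟨_, rfl⟩
  simpa only [Set.mem_ofPred_eq, Category.assoc, IsIso.inv_hom_id, Category.comp_id] using ha

/-! ### Universal quantification -/

variable (C) in
/-- Every composable pair of maps has a `Π`-diagram that is universal on elements. -/
class HasElementwisePi : Prop where
  exists_pi : ∀ ⦃Y X I : C⦄ (g : Y ⟶ X) (f : X ⟶ I),
    ∃ D : PiDiagram g f, D.IsUniversalOnElements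

/-- For the `Π`-diagram of `m` and `f`, an element of `F` over `i` amounts to a section of `m` over
the fibre of `f` at `i`. As `m` is mono, such a section exists exactly when the whole fibre lies in
`S`, so the set is the range of `φ`. -/
theorem Definable.forall [HasElementwisePi C] {X I : C} {S : Set (Element X)} (hS : Definable S)
    (f : X ⟶ I) : Definable {i : Element I | ∀ x : Element X, x ≫ f = i → x ∈ S} := by
  obtain ⟨M, m, hm, h⟩ := hS
  obtain ⟨D, hD⟩ := HasElementwisePi.exists_pi m f
  obtain ⟨K, k, hk, hK⟩ := definable_range D.φ
  refine ⟨K, k, hk, fun i => ?_⟩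
  rw [← hK]
  constructor
  · intro hi
    have hc : pullback.fst f i ≫ f = pullback.snd f i ≫ i := pullback.condition
    have hfib (z : Element (pullback f i)) : (z ≫ pullback.fst f i) ≫ f = i := by
      rw [Category.assoc, hc, ← Category.assoc,
        Subsingleton.elim (z ≫ pullback.snd f i) (𝟙 _), Category.id_comp]
    obtain ⟨w, hw⟩ := exists_lift_of_mem hm (f := pullback.fst f i)
      fun z => (h _).1 (hi _ (hfib z))
    obtain ⟨s, ⟨hs, -⟩, -⟩ := hD i (pullback.fst f i) w inferInstance
      (by
        rintro x y ⟨a, rfl, rfl⟩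
        exact ⟨by simp [hw], hfib a⟩)
      (fun x hx => ⟨pullback.lift x (𝟙 _) (by simp [hx]) ≫ w,
        pullback.lift x (𝟙 _) (by simp [hx]), by simp, rfl⟩)
    exact ⟨s, hs⟩
  · rintro ⟨s, rfl⟩ x hx
    refine (h x).2 ⟨D.isPullback.lift s x hx.symm ≫ D.ev, ?_⟩
    rw [Category.assoc, D.ev_comp, D.isPullback.lift_snd]

/-- The fibre of `m` over `x` is inhabited exactly when `x ∈ S`, so implication is quantification
along `m`. -/
theorem Definable.imp [HasElementwisePi C] {X : C} {S T : Set (Element X)} (hS : Definable S)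
    (hT : Definable T) : Definable {x : Element X | x ∈ S → x ∈ T} := by
  obtain ⟨M, m, hm, h⟩ := hS
  obtain ⟨K, k, hk, hK⟩ := (hT.preimage m).forall m
  refine ⟨K, k, hk, fun x => ?_⟩
  rw [← hK]
  constructor
  · rintro hx a rfl
    exact hx ((h _).2 ⟨a, rfl⟩)
  · intro hx hxS
    obtain ⟨a, rfl⟩ := (h x).1 hxS
    exact hx a rfl

end WellPointed

section Universal

variable {C : Type u} [Category.{v} C] [HasFiniteLimits C]

/-! ### `Π`-diagrams -/

/-- Elements `s'` and `s` of the parameter objects of two `Π`-diagrams are compatible if they lie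
over the same element and evaluation at them agrees. -/
def PiDiagram.Compatible {Y X I : C} {g : Y ⟶ X} {f : X ⟶ I} (D' D : PiDiagram g f)
    (s' : Element D'.F) (s : Element D.F) : Prop :=
  s ≫ D.φ = s' ≫ D'.φ ∧ ∀ (t' : Element D'.P) (t : Element D.P), t' ≫ D'.π₁ = s' →
    t ≫ D.π₁ = s → t' ≫ D'.π₂ = t ≫ D.π₂ → t' ≫ D'.ev = t ≫ D.ev

/-- Over a common element of `I`, both graphs are total on the same fibre of `f`, because the
squares are pullbacks; agreement of values is then equality of graphs. The graph form matches
elementwise universality, the other form is a single universal quantification and hence definable.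
-/
theorem PiDiagram.compatible_iff {Y X I : C} {g : Y ⟶ X} {f : X ⟶ I} (D' D : PiDiagram g f)
    (s' : Element D'.F) (s : Element D.F) :
    D'.Compatible D s' s ↔ s ≫ D.φ = s' ≫ D'.φ ∧ ∀ (x : Element X) (y : Element Y),
      Mem₃ s x y D.π₁ D.π₂ D.ev ↔ Mem₃ s' x y D'.π₁ D'.π₂ D'.ev := by
  refine and_congr_right fun hφ => ⟨fun h x y => ⟨?_, ?_⟩, ?_⟩
  · rintro ⟨t, rfl, rfl, rfl⟩
    have hw : s' ≫ D'.φ = (t ≫ D.π₂) ≫ f := by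
      rw [← hφ, Category.assoc, Category.assoc, D.isPullback.w]
    exact ⟨D'.isPullback.lift s' (t ≫ D.π₂) hw, by simp, by simp,
      h _ t (by simp) rfl (by simp)⟩
  · rintro ⟨t, rfl, rfl, rfl⟩
    have hw : s ≫ D.φ = (t ≫ D'.π₂) ≫ f := by
      rw [hφ, Category.assoc, Category.assoc, D'.isPullback.w]
    exact ⟨D.isPullback.lift s (t ≫ D'.π₂) hw, by simp, by simp,
      (h t _ rfl (by simp) (by simp)).symm⟩
  · rintro h t' t rfl rfl h₂
    obtain ⟨u, hu₁, hu₂, hu⟩ := (h _ _).2 ⟨t', rfl, rfl, rfl⟩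
    rw [← hu, D.isPullback.hom_ext hu₁ (hu₂.trans h₂)]

variable [WellPointedRegular C]

/-- The fibre of `D'.π₁` over `s'`, with its maps to `X` and `Y`, is the graph to which elementwise
universality is applied. -/
theorem PiDiagram.IsUniversalOnElements.existsUnique_compatible {Y X I : C} {g : Y ⟶ X}
    {f : X ⟶ I} {D : PiDiagram g f} (hD : D.IsUniversalOnElements) (D' : PiDiagram g f)
    (s' : Element D'.F) : ∃! s, D'.Compatible D s' s := by
  simp only [PiDiagram.compatible_iff]
  have hfst (a : Element (pullback s' D'.π₁)) : (a ≫ pullback.snd s' D'.π₁) ≫ D'.π₁ = s' := by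
    rw [Category.assoc, ← pullback.condition, ← Category.assoc,
      Subsingleton.elim (a ≫ pullback.fst s' D'.π₁) (𝟙 _), Category.id_comp]
  have hmem (x : Element X) (y : Element Y) : Mem₃ s' x y D'.π₁ D'.π₂ D'.ev ↔
      Mem₂ x y (pullback.snd s' D'.π₁ ≫ D'.π₂) (pullback.snd s' D'.π₁ ≫ D'.ev) := by
    constructor
    · rintro ⟨t, ht, rfl, rfl⟩
      exact ⟨pullback.lift (𝟙 _) t (by simp [ht]), by simp, by simp⟩
    · rintro ⟨a, rfl, rfl⟩
      exact ⟨a ≫ pullback.snd s' D'.π₁, hfst a, by simp, by simp⟩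
  simp only [hmem]
  refine hD (s' ≫ D'.φ) _ _ (mono_of_injective fun a b hab => ?_) ?_ ?_
  · refine pullback.hom_ext (Subsingleton.elim _ _) (D'.isPullback.hom_ext ?_ (by simpa using hab))
    rw [hfst, hfst]
  · rintro x y ⟨a, rfl, rfl⟩
    constructor
    · simp [D'.ev_comp]
    · conv_rhs => rw [← hfst a]
      simp [D'.isPullback.w]
  · intro x hx
    exact ⟨_, pullback.lift (𝟙 _) (D'.isPullback.lift s' x hx.symm) (by simp), by simp, rfl⟩

theorem PiDiagram.definable_compatible [HasElementwisePi C] {Y X I : C} {g : Y ⟶ X} {f : X ⟶ I}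
    (D' D : PiDiagram g f) : Definable {z : Element (D'.F ⨯ D.F) |
      D'.Compatible D (z ≫ prod.fst) (z ≫ prod.snd)} := by
  refine ((definable_eq (prod.snd ≫ D.φ) (prod.fst ≫ D'.φ)).inter
    ((definable_eq (pullback.fst D'.π₂ D.π₂ ≫ D'.ev) (pullback.snd D'.π₂ D.π₂ ≫ D.ev)).forall
      (prod.lift (pullback.fst D'.π₂ D.π₂ ≫ D'.π₁) (pullback.snd D'.π₂ D.π₂ ≫ D.π₁)))).congr
    fun z => and_congr (by simp) ⟨fun h t' t ht' ht htt => ?_, ?_⟩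
  · simpa using h (pullback.lift t' t htt)
      (Limits.prod.hom_ext (by simp [ht']) (by simp [ht]))
  · rintro h w rfl
    simpa using h (w ≫ pullback.fst _ _) (w ≫ pullback.snd _ _) (by simp) (by simp)
      (by simp [pullback.condition])

/-- Compatibility is definable and functional, so it is the graph of a map `n`. Any morphism of
`Π`-diagrams sends each element to a compatible one, which gives uniqueness. -/
theorem PiDiagram.IsUniversalOnElements.isUniversal [HasElementwisePi C] {Y X I : C} {g : Y ⟶ X}
    {f : X ⟶ I} {D : PiDiagram g f} (hD : D.IsUniversalOnElements) : D.IsUniversal := by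
  intro D'
  obtain ⟨n, hn⟩ := (PiDiagram.definable_compatible D' D).exists_hom
    (hD.existsUnique_compatible D')
  have hnφ : n ≫ D.φ = D'.φ := element_ext fun s => by simpa using (hn s).1
  refine ⟨n, ⟨hnφ, D.isPullback.lift (D'.π₁ ≫ n) D'.π₂ (by simp [hnφ, D'.isPullback.w]), by simp,
    by simp, element_ext fun t => ?_⟩, ?_⟩
  · simpa using ((hn (t ≫ D'.π₁)).2 t (t ≫ D.isPullback.lift (D'.π₁ ≫ n) D'.π₂
      (by simp [hnφ, D'.isPullback.w])) rfl (by simp) (by simp)).symm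
  · rintro n' ⟨hφ, m, hm₁, hm₂, hm⟩
    refine element_ext fun s => (hD.existsUnique_compatible D' s).unique ⟨by simp [hφ], ?_⟩ (hn s)
    rintro t' t rfl ht h₂
    have : t = t' ≫ m := D.isPullback.hom_ext (by simp [hm₁, ht]) (by simp [hm₂, h₂])
    simp [this, hm]

end Universal

section Sums

variable {C : Type u} [Category.{v} C]

/-! ### Sums -/

theorem exists_desc_of_isColimit {A B S D : C} {i : A ⟶ S} {j : B ⟶ S}
    (hc : IsColimit (BinaryCofan.mk i j)) (f : A ⟶ D) (g : B ⟶ D) :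
    ∃ l : S ⟶ D, i ≫ l = f ∧ j ≫ l = g := by
  obtain ⟨l, hl, hr⟩ := BinaryCofan.IsColimit.desc' hc f g
  exact ⟨l, hl, hr⟩

variable [HasFiniteLimits C]

/-- The element `x` provides a constant map `B ⟶ A`, which extends the identity of `A` to a
retraction of `i`. -/
theorem injective_inl_of_isColimit {A B S : C} {i : A ⟶ S} {j : B ⟶ S}
    (hc : IsColimit (BinaryCofan.mk i j)) (x y : Element A) (h : x ≫ i = y ≫ i) : x = y := by
  obtain ⟨l, hl, -⟩ := exists_desc_of_isColimit hc (𝟙 A) (terminal.from B ≫ x)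
  simpa [hl] using congr($h ≫ l)

theorem injective_inr_of_isColimit {A B S : C} {i : A ⟶ S} {j : B ⟶ S}
    (hc : IsColimit (BinaryCofan.mk i j)) (x y : Element B) (h : x ≫ j = y ≫ j) : x = y := by
  obtain ⟨l, -, hl⟩ := exists_desc_of_isColimit hc (terminal.from A ≫ x) (𝟙 B)
  simpa [hl] using congr($h ≫ l)

variable [HasBinaryCoproducts C]

/-- Collapsing each summand to a point maps `S` to `1 + 1`, where nontriviality separates the two
injections. -/
theorem inl_ne_inr_of_isColimit (nt : ∀ ⦃S : C⦄ (x y : Element S),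
      Nonempty (IsColimit (BinaryCofan.mk x y)) → x ≠ y) {A B S : C} {i : A ⟶ S} {j : B ⟶ S}
    (hc : IsColimit (BinaryCofan.mk i j)) (x : Element A) (y : Element B) : x ≫ i ≠ y ≫ j := by
  intro h
  let T : C := ⊤_ C
  obtain ⟨l, hl, hr⟩ := exists_desc_of_isColimit hc
    (terminal.from A ≫ (coprod.inl : T ⟶ T ⨿ T)) (terminal.from B ≫ (coprod.inr : T ⟶ T ⨿ T))
  refine nt (coprod.inl : T ⟶ T ⨿ T) coprod.inr ⟨coprodIsCoprod T T⟩ ?_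
  have h' := congr($h ≫ l)
  rw [Category.assoc, Category.assoc, hl, hr, ← Category.assoc, ← Category.assoc,
    Subsingleton.elim (x ≫ terminal.from A) (𝟙 _),
    Subsingleton.elim (y ≫ terminal.from B) (𝟙 _)] at h'
  simpa only [Category.id_comp] using h'

variable [WellPointedRegular C]

theorem nonempty_isColimit_of_elements (dp : DisjunctionProperty C) {A B S : C} {i : A ⟶ S}
    {j : B ⟶ S} (hl : ∀ x y : Element A, x ≫ i = y ≫ i → x = y)
    (hr : ∀ x y : Element B, x ≫ j = y ≫ j → x = y)
    (hlr : ∀ (x : Element A) (y : Element B), x ≫ i ≠ y ≫ j)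
    (hs : ∀ z : Element S, Mem z i ∨ Mem z j) : Nonempty (IsColimit (BinaryCofan.mk i j)) := by
  have : IsIso (coprod.desc i j) := isIso_of_bijective
    (fun z => by
      rcases hs z with ⟨x, rfl⟩ | ⟨x, rfl⟩
      · exact ⟨x ≫ coprod.inl, by simp⟩
      · exact ⟨x ≫ coprod.inr, by simp⟩)
    (fun z w h => by
      rcases dp _ _ ⟨coprodIsCoprod A B⟩ z with ⟨x, rfl⟩ | ⟨x, rfl⟩ <;>
      rcases dp _ _ ⟨coprodIsCoprod A B⟩ w with ⟨y, rfl⟩ | ⟨y, rfl⟩ <;>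
      simp only [Category.assoc, coprod.inl_desc, coprod.inr_desc] at h
      · rw [hl x y h]
      · exact (hlr x y h).elim
      · exact (hlr y x h.symm).elim
      · rw [hr x y h])
  let e : A ⨿ B ≅ S := asIso (coprod.desc i j)
  exact ⟨(coprodIsCoprod A B).ofIsoColimit
    (BinaryCofan.ext e (coprod.inl_desc i j) (coprod.inr_desc i j))⟩

/-- This is the van Kampen property on elements. From left to right, disjunction is applied to `S'`,
and disjointness in `S` excludes the wrong summand; from right to left, it is applied in `S` to the
image of an element of `S'`. -/
theorem nonempty_isColimit_iff_isPullback (dp : DisjunctionProperty C)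
    (nt : ∀ ⦃S : C⦄ (x y : Element S), Nonempty (IsColimit (BinaryCofan.mk x y)) → x ≠ y)
    {A B S A' B' S' : C} {i : A ⟶ S} {j : B ⟶ S} (hc : IsColimit (BinaryCofan.mk i j))
    {i' : A' ⟶ S'} {j' : B' ⟶ S'} {α : A' ⟶ A} {β : B' ⟶ B} {f : S' ⟶ S}
    (hα : α ≫ i = i' ≫ f) (hβ : β ≫ j = j' ≫ f) :
    Nonempty (IsColimit (BinaryCofan.mk i' j')) ↔
      IsPullback i' α f i ∧ IsPullback j' β f j := by
  have hα' (x : Element A') : (x ≫ i') ≫ f = (x ≫ α) ≫ i := by simp [hα]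
  have hβ' (x : Element B') : (x ≫ j') ≫ f = (x ≫ β) ≫ j := by simp [hβ]
  constructor
  · rintro ⟨hc'⟩
    constructor
    · refine isPullback_of_elements hα.symm
        (fun z z' h _ => injective_inl_of_isColimit hc' z z' h) fun z a h => ?_
      rcases dp _ _ ⟨hc'⟩ z with ⟨x, rfl⟩ | ⟨x, rfl⟩
      · exact ⟨x, rfl, injective_inl_of_isColimit hc _ _ ((hα' x).symm.trans h)⟩
      · exact (inl_ne_inr_of_isColimit nt hc _ _ (h.symm.trans (hβ' x))).elim
    · refine isPullback_of_elements hβ.symm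
        (fun z z' h _ => injective_inr_of_isColimit hc' z z' h) fun z a h => ?_
      rcases dp _ _ ⟨hc'⟩ z with ⟨x, rfl⟩ | ⟨x, rfl⟩
      · exact (inl_ne_inr_of_isColimit nt hc _ _ ((hα' x).symm.trans h)).elim
      · exact ⟨x, rfl, injective_inr_of_isColimit hc _ _ ((hβ' x).symm.trans h)⟩
  · rintro ⟨hl, hr⟩
    refine nonempty_isColimit_of_elements dp (fun x y h => hl.hom_ext h ?_)
      (fun x y h => hr.hom_ext h ?_) (fun x y h => ?_) fun z => ?_
    · exact injective_inl_of_isColimit hc _ _ (by rw [← hα', ← hα', h])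
    · exact injective_inr_of_isColimit hc _ _ (by rw [← hβ', ← hβ', h])
    · exact inl_ne_inr_of_isColimit nt hc _ _ (by rw [← hα', ← hβ', h])
    · rcases dp _ _ ⟨hc⟩ (z ≫ f) with ⟨x, hx⟩ | ⟨x, hx⟩
      · exact .inl ⟨hl.lift z x hx.symm, by simp⟩
      · exact .inr ⟨hr.lift z x hx.symm, by simp⟩

theorem isVanKampenColimit_of_disjunction (dp : DisjunctionProperty C)
    (nt : ∀ ⦃S : C⦄ (x y : Element S), Nonempty (IsColimit (BinaryCofan.mk x y)) → x ≠ y)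
    {A B : C} (c : BinaryCofan A B) (hc : IsColimit c) : IsVanKampenColimit c := by
  rw [BinaryCofan.isVanKampen_iff]
  intro A' B' c' α β f hα hβ
  exact (IsColimit.equivIsoColimit (isoBinaryCofanMk c')).nonempty_congr.trans
    (nonempty_isColimit_iff_isPullback dp nt (hc.ofIsoColimit (isoBinaryCofanMk c)) hα hβ)

end Sums

section OfCETCS

variable {C : Type u} [Category.{v} C]

/-! ### CETCS implies the categorical properties -/

theorem CETCS.hasFiniteLimits (h : CETCS C) : HasFiniteLimits C := by
  have := h.hasTerminal
  have := h.hasBinaryProducts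
  have := h.hasEqualizers
  have := hasFiniteProducts_of_has_binary_and_terminal (C := C)
  exact hasFiniteLimits_of_hasEqualizers_and_finite_products

theorem CETCS.wellPointedRegular (h : CETCS C) [HasFiniteLimits C] : WellPointedRegular C where
  generation := h.generation
  factorization := h.factorization

theorem CETCS.hasElementwisePi (h : CETCS C) [HasFiniteLimits C] : HasElementwisePi C where
  exists_pi := h.dependentProducts

theorem CETCS.finitaryExtensive (h : CETCS C) : FinitaryExtensive C := by
  have := h.hasFiniteLimits
  have := h.wellPointedRegular
  have := h.hasInitial
  have := h.hasBinaryCoproducts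
  have := hasFiniteCoproducts_of_has_binary_and_initial (C := C)
  exact { van_kampen' := isVanKampenColimit_of_disjunction h.disjunction h.nontriviality }

theorem CETCS.locallyCartesianClosed (h : CETCS C) : LocallyCartesianClosed C := by
  have := h.hasFiniteLimits
  have := h.wellPointedRegular
  have := h.hasElementwisePi
  refine { exists_universal := fun Y X I g f => ?_ }
  obtain ⟨D, hD⟩ := h.dependentProducts g f
  exact ⟨D, hD.isUniversal⟩

variable [HasFiniteLimits C]

theorem onto_of_isPullback {P A B D : C} {p : P ⟶ A} {q : P ⟶ B} {f : A ⟶ D} {g : B ⟶ D}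
    (h : IsPullback p q f g) (hg : Onto g) : Onto p := by
  intro x
  obtain ⟨y, hy⟩ := hg (x ≫ f)
  exact ⟨h.lift x y hy.symm, by simp⟩

variable [WellPointedRegular C]

theorem isImageFactorization_of_onto {A I B : C} {e : A ⟶ I} {m : I ⟶ B} (he : Onto e)
    (hm : Mono m) : IsImageFactorization (e ≫ m) e m := by
  refine ⟨hm, rfl, fun I' e' m' hm' h => exists_lift_of_mem hm' fun x => ?_⟩
  obtain ⟨a, rfl⟩ := he x
  exact ⟨a ≫ e', by simp [h]⟩

theorem WellPointedRegular.regularCategory : RegularCategory C where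
  exists_image A B f := by
    obtain ⟨I, e, i, he, hi, rfl⟩ := WellPointedRegular.factorization f
    exact ⟨I, e, i, isImageFactorization_of_onto he hi⟩
  cover_of_isPullback P A B D p q f g h hg := by
    rw [isCover_iff_onto] at hg ⊢
    exact onto_of_isPullback h hg

theorem IsEquivalenceRelation.isKernelPair_of_elements {R X E : C} {r₁ r₂ : R ⟶ X}
    (h : IsEquivalenceRelation r₁ r₂) {e : X ⟶ E}
    (he : ∀ x₁ x₂ : Element X, Mem₂ x₁ x₂ r₁ r₂ ↔ x₁ ≫ e = x₂ ≫ e) : IsKernelPair e r₁ r₂ := by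
  obtain ⟨⟨H⟩⟩ := h
  exact isPullback_of_elements
    (element_ext fun a => by simpa using (he (a ≫ r₁) (a ≫ r₂)).1 ⟨a, rfl, rfl⟩)
    (fun z z' h₁ h₂ => H.right_cancellation z z' h₁ h₂) (fun x y hxy => (he x y).2 hxy)

theorem isProjective_terminal : IsProjective (⊤_ C) := fun _ _ e he h =>
  (isCover_iff_onto e).1 he h

/-- The pullback of the cover along `h` is onto `P`; a section of it yields the lift. -/
theorem IsChoiceObject.isProjective {P : C} (hP : IsChoiceObject P) : IsProjective P := by
  intro A B e he h
  obtain ⟨s, hs⟩ := hP (pullback.fst h e)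
    (onto_of_isPullback (IsPullback.of_hasPullback h e) ((isCover_iff_onto e).1 he))
  exact ⟨s ≫ pullback.snd h e, by rw [Category.assoc, ← pullback.condition, reassoc_of% hs]⟩

omit [WellPointedRegular C] [HasFiniteLimits C] in
theorem CETCS.pretopos (h : CETCS C) : Pretopos C := by
  have := h.hasFiniteLimits
  have := h.wellPointedRegular
  have := WellPointedRegular.regularCategory (C := C)
  have := h.finitaryExtensive
  refine { effective := fun R X r₁ r₂ hr => ?_ }
  obtain ⟨E, e, he⟩ := h.effectiveness r₁ r₂ hr
  exact ⟨E, e, IsEquivalenceRelation.isKernelPair_of_elements hr he⟩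

end OfCETCS

section NaturalNumbers

variable {C : Type u} [Category.{v} C] [HasFiniteLimits C]

/-! ### Natural numbers objects -/

/-- `N` with `zero` and `succ` is a natural numbers object. -/
def IsNNO {N : C} (zero : ⊤_ C ⟶ N) (succ : N ⟶ N) : Prop :=
  ∀ ⦃A : C⦄ (b : ⊤_ C ⟶ A) (h : A ⟶ A), ∃! f : N ⟶ A, zero ≫ f = b ∧ succ ≫ f = f ≫ h

variable {N : C} {zero : ⊤_ C ⟶ N} {succ : N ⟶ N}

theorem IsNNO.eq_id (hN : IsNNO zero succ) {f : N ⟶ N} (h₀ : zero ≫ f = zero)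
    (hs : succ ≫ f = f ≫ succ) : f = 𝟙 N :=
  (hN zero succ).unique ⟨h₀, hs⟩ ⟨by simp, by simp⟩

/-- Recursion with a counter: the state at `n` is `(k n, n)`, and the next state `(h n, n + 1)`
ignores the first component. -/
theorem IsNNO.exists_cons (hN : IsNNO zero succ) {B : C} (b : Element B) (h : N ⟶ B) :
    ∃ k : N ⟶ B, zero ≫ k = b ∧ succ ≫ k = h := by
  obtain ⟨f, ⟨h₀, hs⟩, -⟩ := hN (prod.lift b zero) (prod.lift (prod.snd ≫ h) (prod.snd ≫ succ))
  have hf : f ≫ prod.snd = 𝟙 N := hN.eq_id (by simp [reassoc_of% h₀]) (by simp [reassoc_of% hs])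
  exact ⟨f ≫ prod.fst, by simp [reassoc_of% h₀], by simp [reassoc_of% hs, reassoc_of% hf]⟩

variable [WellPointedRegular C]

/-- The subobject inherits zero and successor, so recursion maps `N` into it; by uniqueness this map
is a section of the inclusion. -/
theorem IsNNO.induction (hN : IsNNO zero succ) {S : Set (Element N)} (hS : Definable S)
    (h₀ : zero ∈ S) (hs : ∀ n ∈ S, n ≫ succ ∈ S) (n : Element N) : n ∈ S := by
  obtain ⟨M, m, hm, hM⟩ := hS
  obtain ⟨z, hz⟩ := (hM _).1 h₀
  obtain ⟨s, hs⟩ := exists_lift_of_mem hm (f := m ≫ succ) fun x => by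
    simpa using (hM _).1 (hs _ ((hM _).2 ⟨x, rfl⟩))
  obtain ⟨f, ⟨hf₀, hf⟩, -⟩ := hN z s
  have : f ≫ m = 𝟙 N := hN.eq_id (by simp [reassoc_of% hf₀, hz]) (by simp [reassoc_of% hf, hs])
  exact (hM n).2 ⟨n ≫ f, by simp [this]⟩

end NaturalNumbers

section TransitiveClosure

variable {C : Type u} [Category.{v} C] [HasFiniteLimits C]

/-! ### The equivalence relation generated by a reflexive and symmetric relation -/

/-- `F` is the dependent product of `A ⨯ B ⟶ A` along `A ⟶ 1`, in the role of the exponential, with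
`w` as evaluation. Only the existence of a name for each map is needed. -/
theorem exists_parametrization_of_homs [HasElementwisePi C] (A B : C) :
    ∃ (F : C) (w : A ⨯ F ⟶ B), ∀ h : A ⟶ B, ∃ s : Element F, ∀ a : Element A,
      prod.lift a s ≫ w = a ≫ h := by
  obtain ⟨D, hD⟩ := HasElementwisePi.exists_pi (prod.fst : A ⨯ B ⟶ A) (terminal.from A)
  refine ⟨D.F, D.isPullback.lift prod.snd prod.fst (Subsingleton.elim _ _) ≫ D.ev ≫ prod.snd,
    fun h => ?_⟩
  obtain ⟨s, ⟨-, hs⟩, -⟩ := hD (𝟙 _) (𝟙 A) (prod.lift (𝟙 A) h) inferInstance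
    (by
      rintro x y ⟨a, rfl, rfl⟩
      exact ⟨by simp, Subsingleton.elim _ _⟩)
    (fun x _ => ⟨_, x, by simp, rfl⟩)
  refine ⟨s, fun a => ?_⟩
  obtain ⟨t, rfl, rfl, ht⟩ := (hs a (a ≫ prod.lift (𝟙 A) h)).2 ⟨a, by simp, rfl⟩
  have : prod.lift (t ≫ D.π₂) (t ≫ D.π₁) ≫
      D.isPullback.lift prod.snd prod.fst (Subsingleton.elim _ _) = t :=
    D.isPullback.hom_ext (by simp) (by simp)
  rw [reassoc_of% this, reassoc_of% ht]
  simp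

variable {N : C} (zero : ⊤_ C ⟶ N) (succ : N ⟶ N)

/-- `b'` can be reached from `b` along an internal sequence of `r`-steps. -/
def Reachable {B : C} (r : Element B → Element B → Prop) (b b' : Element B) : Prop :=
  ∃ h : N ⟶ B, (∀ n : Element N, r (n ≫ h) (n ≫ succ ≫ h)) ∧ zero ≫ h = b ∧
    ∃ n : Element N, n ≫ h = b'

variable {zero succ} {B : C} {r : Element B → Element B → Prop}

theorem Reachable.refl (hr : ∀ b, r b b) (b : Element B) : Reachable zero succ r b b :=
  ⟨terminal.from N ≫ b, fun n => by simpa using hr b, by simp, zero, by simp⟩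

variable [WellPointedRegular C]

variable (zero succ) in
-- Quantification over sequences becomes quantification over their names in `F`: the relation is the
-- image, under `(n, s) ↦ (s 0, s n)`, of the pairs in which `s` names a sequence of `r`-steps.
theorem Reachable.definable [HasElementwisePi C]
    (hr : Definable {z : Element (B ⨯ B) | r (z ≫ prod.fst) (z ≫ prod.snd)}) :
    Definable {z : Element (B ⨯ B) |
      Reachable zero succ r (z ≫ prod.fst) (z ≫ prod.snd)} := by
  obtain ⟨F, w, hw⟩ := exists_parametrization_of_homs N B
  have hP := (hr.preimage (prod.lift w (prod.map succ (𝟙 F) ≫ w))).forall prod.snd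
  refine ((hP.preimage (prod.snd : N ⨯ F ⟶ F)).image
    (prod.lift (prod.lift (terminal.from _ ≫ zero) prod.snd ≫ w) w)).congr fun z => ?_
  have keyz (x : Element (N ⨯ F)) :
      x ≫ prod.lift (terminal.from _ ≫ zero) prod.snd = prod.lift zero (x ≫ prod.snd) :=
    Limits.prod.hom_ext (by simp) (by simp)
  constructor
  · rintro ⟨x, hx, rfl⟩
    obtain ⟨h, hh⟩ : ∃ h : N ⟶ B, ∀ n : Element N,
        n ≫ h = prod.lift n (x ≫ prod.snd) ≫ w := by
      refine ⟨prod.lift (𝟙 N) (terminal.from N ≫ x ≫ prod.snd) ≫ w, fun n => ?_⟩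
      rw [← Category.assoc]
      congr 1
      exact Limits.prod.hom_ext (by simp) (by simp)
    refine ⟨h, fun n => ?_, ?_, x ≫ prod.fst, ?_⟩
    · have := hx (prod.lift n (x ≫ prod.snd)) (by simp)
      rw [← Category.assoc n, hh, hh]
      simpa using this
    · rw [hh, Category.assoc, prod.lift_fst, ← Category.assoc, keyz]
    · rw [hh, Category.assoc, prod.lift_snd]
      congr 1
      exact Limits.prod.hom_ext (by simp) (by simp)
  · rintro ⟨h, hh, h₀, n, hn⟩
    obtain ⟨s, hs⟩ := hw h
    refine ⟨prod.lift n s, fun x hx => ?_, Limits.prod.hom_ext ?_ ?_⟩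
    · have hx' : x = prod.lift (x ≫ prod.fst) s :=
        Limits.prod.hom_ext (by simp) (by simpa using hx)
      have := hh (x ≫ prod.fst)
      rw [← Category.assoc (x ≫ prod.fst), ← hs, ← hs] at this
      rw [hx']
      simpa using this
    · rw [Category.assoc, prod.lift_fst, ← Category.assoc, keyz, prod.lift_snd, hs, h₀]
    · rw [Category.assoc, prod.lift_snd, hs, hn]

variable (hN : IsNNO zero succ)
include hN

theorem Reachable.head
    (hr : Definable {z : Element (B ⨯ B) | r (z ≫ prod.fst) (z ≫ prod.snd)})
    {b b' b'' : Element B} (h : r b b') (h' : Reachable zero succ r b' b'') :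
    Reachable zero succ r b b'' := by
  obtain ⟨q, hq, rfl, n, rfl⟩ := h'
  obtain ⟨k, rfl, rfl⟩ := hN.exists_cons b q
  refine ⟨k, fun n => ?_, rfl, n ≫ succ, by simp⟩
  -- Induction serves only as the case distinction between zero and successor.
  simpa using hN.induction (hr.preimage (prod.lift k (succ ≫ k))) (by simpa using h)
    (fun n _ => by simpa using hq n) n

theorem Reachable.of_rel
    (hrefl : ∀ b, r b b) (hr : Definable {z : Element (B ⨯ B) | r (z ≫ prod.fst) (z ≫ prod.snd)})
    {b b' : Element B} (h : r b b') : Reachable zero succ r b b' :=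
  Reachable.head hN hr h (Reachable.refl hrefl b')

variable [HasElementwisePi C]

theorem Reachable.trans
    (hr : Definable {z : Element (B ⨯ B) | r (z ≫ prod.fst) (z ≫ prod.snd)})
    {b b' b'' : Element B} (h : Reachable zero succ r b b')
    (h' : Reachable zero succ r b' b'') : Reachable zero succ r b b'' := by
  obtain ⟨q, hq, rfl, n, rfl⟩ := h
  have hd : Definable {x : Element B | Reachable zero succ r x b''} := by
    refine ((Reachable.definable zero succ hr).preimage
      (prod.lift (𝟙 B) (terminal.from B ≫ b''))).congr fun x => by simp
  -- The conclusion of the implication does not depend on `n`; it is made definable as a preimage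
  -- under a constant map. The induction shows that if `q n` reaches `b''`, so does `q 0`.
  have hd₀ : Definable {_n : Element N | Reachable zero succ r (zero ≫ q) b''} := by
    refine (hd.preimage (terminal.from N ≫ zero ≫ q)).congr fun x => by simp
  refine hN.induction ((hd.preimage q).imp hd₀) (fun h => h) (fun n ih h => ih ?_) n h'
  refine Reachable.head hN hr (hq n) ?_
  simpa using h

theorem Reachable.symm (hrefl : ∀ b, r b b) (hsymm : ∀ b b', r b b' → r b' b)
    (hr : Definable {z : Element (B ⨯ B) | r (z ≫ prod.fst) (z ≫ prod.snd)})
    {b b' : Element B} (h : Reachable zero succ r b b') : Reachable zero succ r b' b := by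
  obtain ⟨q, hq, rfl, n, rfl⟩ := h
  have := hN.induction ((Reachable.definable zero succ hr).preimage
    (prod.lift q (terminal.from N ≫ zero ≫ q))) (by simpa using Reachable.refl hrefl _)
    (fun n ih => by
      simp only [Set.mem_ofPred_eq, Category.assoc, prod.lift_fst, prod.lift_snd, terminal.comp_from_assoc,
        terminal_from_self_comp] at ih ⊢
      exact Reachable.trans hN hr (Reachable.of_rel hN hrefl hr (hsymm _ _ (hq n))) ih) n
  simpa using this

omit [HasElementwisePi C] in
theorem Reachable.comp_eq {Z : C} (h : B ⟶ Z) (hh : ∀ b b', r b b' → b ≫ h = b' ≫ h)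
    {b b' : Element B} (H : Reachable zero succ r b b') : b ≫ h = b' ≫ h := by
  obtain ⟨q, hq, rfl, n, rfl⟩ := H
  have := hN.induction (definable_eq (q ≫ h) (terminal.from N ≫ zero ≫ q ≫ h))
    (by simp) (fun n ih => by
      simp only [Set.mem_ofPred_eq, Category.assoc, terminal.comp_from_assoc,
        terminal_from_self_comp] at ih ⊢
      rw [← ih]
      simpa using (hh _ _ (hq n)).symm) n
  simpa using this.symm

end TransitiveClosure

section Coequalizers

variable {C : Type u} [Category.{v} C] [HasFiniteLimits C] [WellPointedRegular C]

/-! ### Coequalizers -/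

/-- The reflexivity, symmetry and transitivity maps are lifts through `m`, which exist because they
exist on elements. -/
theorem isEquivalenceRelation_of_elements {B M : C} {m : M ⟶ B ⨯ B} (hm : Mono m)
    {t : Element B → Element B → Prop} (ht : Equivalence t)
    (hM : ∀ z : Element (B ⨯ B), t (z ≫ prod.fst) (z ≫ prod.snd) ↔ Mem z m) :
    IsEquivalenceRelation (m ≫ prod.fst) (m ≫ prod.snd) := by
  have hmem {X : C} (p q : X ⟶ B) (h : ∀ x : Element X, t (x ≫ p) (x ≫ q)) :
      ∃ k : X ⟶ M, k ≫ m ≫ prod.fst = p ∧ k ≫ m ≫ prod.snd = q := by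
    obtain ⟨k, hk⟩ := exists_lift_of_mem hm (f := prod.lift p q) fun x => (hM _).1 (by simpa using h x)
    exact ⟨k, by simp [reassoc_of% hk], by simp [reassoc_of% hk]⟩
  have hmt (x : Element M) : t (x ≫ m ≫ prod.fst) (x ≫ m ≫ prod.snd) := by
    simpa using (hM (x ≫ m)).2 ⟨x, rfl⟩
  obtain ⟨ρ, hρ₁, hρ₂⟩ := hmem (𝟙 B) (𝟙 B) fun x => ht.refl _
  obtain ⟨σ, hσ₁, hσ₂⟩ := hmem (m ≫ prod.snd) (m ≫ prod.fst) fun x => ht.symm (hmt x)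
  obtain ⟨τ, hτ₁, hτ₂⟩ := hmem
    (pullback.fst (m ≫ prod.snd) (m ≫ prod.fst) ≫ m ≫ prod.fst)
    (pullback.snd (m ≫ prod.snd) (m ≫ prod.fst) ≫ m ≫ prod.snd) fun x => by
      have h₁ := hmt (x ≫ pullback.fst (m ≫ prod.snd) (m ≫ prod.fst))
      have h₂ := hmt (x ≫ pullback.snd (m ≫ prod.snd) (m ≫ prod.fst))
      rw [Category.assoc, Category.assoc] at h₁ h₂
      rw [pullback.condition] at h₁
      exact ht.trans h₁ h₂
  exact ⟨⟨{
    right_cancellation := fun Y f g h₁ h₂ => by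
      rw [← cancel_mono m]
      exact Limits.prod.hom_ext (by simpa using h₁) (by simpa using h₂)
    r := ρ
    reflexivity₁ := hρ₁
    reflexivity₂ := hρ₂
    s := σ
    symmetry₁ := hσ₁
    symmetry₂ := hσ₂
    c := pullback.cone (m ≫ prod.snd) (m ≫ prod.fst)
    isLimit := pullback.isLimit _ _
    t := τ
    transitivity₁ := hτ₁
    transitivity₂ := hτ₂ }⟩⟩

theorem Onto.epi {A B : C} {e : A ⟶ B} (he : Onto e) : Epi e :=
  ⟨fun u w h => element_ext fun y => by
    obtain ⟨x, rfl⟩ := he y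
    simp [h]⟩

theorem hasCoequalizers_of_effective [HasBinaryCoproducts C] [HasElementwisePi C]
    (hN : HasNNO C)
    (eff : ∀ ⦃R X : C⦄ (r₁ r₂ : R ⟶ X), IsEquivalenceRelation r₁ r₂ →
      ∃ (E : C) (e : X ⟶ E), ∀ x₁ x₂ : Element X, Mem₂ x₁ x₂ r₁ r₂ ↔ x₁ ≫ e = x₂ ≫ e) :
    HasCoequalizers C := by
  obtain ⟨N, zero, succ, hN : IsNNO zero succ⟩ := hN
  suffices ∀ {A B : C} {f g : A ⟶ B}, HasColimit (parallelPair f g) from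
    hasCoequalizers_of_hasColimit_parallelPair C
  intro A B f g
  -- The range of `u` consists of the pairs `(f a, g a)`, `(g a, f a)` and `(b, b)`: the reflexive
  -- and symmetric closure, whose transitive closure is `Reachable`.
  let u : A ⨿ (A ⨿ B) ⟶ B ⨯ B :=
    coprod.desc (prod.lift f g) (coprod.desc (prod.lift g f) (prod.lift (𝟙 B) (𝟙 B)))
  let r (b b' : Element B) : Prop := Mem (prod.lift b b') u
  have hr : Definable {z : Element (B ⨯ B) | r (z ≫ prod.fst) (z ≫ prod.snd)} := by
    refine (definable_range u).congr fun z => ?_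
    have : prod.lift (z ≫ prod.fst) (z ≫ prod.snd) = z :=
      Limits.prod.hom_ext (by simp) (by simp)
    simp [r, this]
  have hrefl (b : Element B) : r b b :=
    ⟨b ≫ coprod.inr ≫ coprod.inr, Limits.prod.hom_ext (by simp [u]) (by simp [u])⟩
  have hrfg (a : Element A) : r (a ≫ f) (a ≫ g) :=
    ⟨a ≫ coprod.inl, Limits.prod.hom_ext (by simp [u]) (by simp [u])⟩
  have hsymm (b b' : Element B) (h : r b b') : r b' b := by
    obtain ⟨a, ha⟩ := h
    let σ : A ⨿ (A ⨿ B) ⟶ A ⨿ (A ⨿ B) :=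
      coprod.desc (coprod.inl ≫ coprod.inr) (coprod.desc coprod.inl (coprod.inr ≫ coprod.inr))
    have hu : σ ≫ u = u ≫ prod.lift prod.snd prod.fst := by
      refine coprod.hom_ext ?_ (coprod.hom_ext ?_ ?_) <;>
        refine Limits.prod.hom_ext ?_ ?_ <;> simp [u, σ]
    refine ⟨a ≫ σ, ?_⟩
    rw [Category.assoc, hu, reassoc_of% ha]
    exact Limits.prod.hom_ext (by simp) (by simp)
  have hrh {Z : C} (h : B ⟶ Z) (hfg : f ≫ h = g ≫ h) (b b' : Element B) (hb : r b b') :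
      b ≫ h = b' ≫ h := by
    obtain ⟨a, ha⟩ := hb
    have hu : u ≫ prod.fst ≫ h = u ≫ prod.snd ≫ h := by
      refine coprod.hom_ext ?_ (coprod.hom_ext ?_ ?_) <;> simp [u, hfg]
    simpa [reassoc_of% ha] using congr(a ≫ $hu)
  obtain ⟨M, m, hm, hM⟩ := Reachable.definable zero succ hr
  obtain ⟨E, e, he⟩ := eff _ _ (isEquivalenceRelation_of_elements hm
    ⟨Reachable.refl hrefl, Reachable.symm hN hrefl hsymm hr, Reachable.trans hN hr⟩ hM)
  have hE (b b' : Element B) : Reachable zero succ r b b' ↔ b ≫ e = b' ≫ e := by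
    rw [← he]
    constructor
    · intro h
      obtain ⟨a, ha⟩ := (hM (prod.lift b b')).1 (by simpa using h)
      exact ⟨a, by simp [reassoc_of% ha], by simp [reassoc_of% ha]⟩
    · rintro ⟨a, rfl, rfl⟩
      simpa using (hM (a ≫ m)).2 ⟨a, rfl⟩
  -- The quotient map `e` need not be onto. Its image has the same kernel pair, and maps out of it
  -- are determined and constructed on elements.
  obtain ⟨Q, q, i, hq, hi, rfl⟩ := WellPointedRegular.factorization e
  have hQ (b b' : Element B) : Reachable zero succ r b b' ↔ b ≫ q = b' ≫ q := by
    rw [hE, ← Category.assoc, ← Category.assoc, cancel_mono]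
  have := hq.epi
  have hfg : f ≫ q = g ≫ q := element_ext fun a => by
    simpa using (hQ _ _).1 (Reachable.of_rel hN hrefl hr (hrfg a))
  have hdesc (s : Cofork f g) : ∃ k : Q ⟶ s.pt, q ≫ k = s.π :=
    exists_factorization_of_onto hq s.π fun b b' h =>
      Reachable.comp_eq hN s.π (hrh s.π s.condition) ((hQ _ _).2 h)
  choose k hk using hdesc
  exact ⟨⟨⟨Cofork.ofπ q hfg, Cofork.IsColimit.mk _ k hk fun s l hl => by
    rw [← cancel_epi q, hk]
    exact hl⟩⟩⟩

end Coequalizers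

section Elementwise

variable {C : Type u} [Category.{v} C] [HasFiniteLimits C]

/-! ### The categorical properties imply CETCS -/

theorem IsKernelPair.mem₂_iff {R X E : C} {e : X ⟶ E} {r₁ r₂ : R ⟶ X} (h : IsKernelPair e r₁ r₂)
    (x₁ x₂ : Element X) : Mem₂ x₁ x₂ r₁ r₂ ↔ x₁ ≫ e = x₂ ≫ e := by
  constructor
  · rintro ⟨a, rfl, rfl⟩
    simp [h.w]
  · exact fun hx => ⟨h.lift x₁ x₂ hx, by simp, by simp⟩

variable [WellPointedRegular C]

/-- Conditions (a) and (b) say that `R` is the fibre of `f` over `i`, so `(ξ, υ)` is a `Π`-diagram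
with parameter object `1`. Its morphisms to `D` are exactly the elements of `D.F` over `i` with
graph `(ξ, υ)`. -/
theorem PiDiagram.IsUniversal.isUniversalOnElements {Y X I : C} {g : Y ⟶ X} {f : X ⟶ I}
    {D : PiDiagram g f} (hD : D.IsUniversal) : D.IsUniversalOnElements := by
  intro i R ξ υ hξ ha hb
  have hgf (a : Element R) : a ≫ υ ≫ g = a ≫ ξ ∧ a ≫ ξ ≫ f = i := by
    simpa using ha _ _ ⟨a, rfl, rfl⟩
  let D' : PiDiagram g f :=
    { F := ⊤_ C
      P := R
      φ := i
      π₁ := terminal.from R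
      π₂ := ξ
      ev := υ
      isPullback := isPullback_of_elements
        (element_ext fun a => by simp [terminal_from_self_comp, (hgf a).2])
        (fun z z' _ h => by rwa [cancel_mono] at h)
        (fun x y h => by
          obtain ⟨_, a, rfl, -⟩ := hb y (by
            rw [← h, Subsingleton.elim x (𝟙 _), Category.id_comp])
          exact ⟨a, Subsingleton.elim _ _, rfl⟩)
      ev_comp := element_ext fun a => (hgf a).1 }
  have hgraph (s : Element D.F) : (s ≫ D.φ = i ∧ ∀ (x : Element X) (y : Element Y),
      Mem₃ s x y D.π₁ D.π₂ D.ev ↔ Mem₂ x y ξ υ) ↔ (s ≫ D.φ = D'.φ ∧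
      ∃ m : D'.P ⟶ D.P, m ≫ D.π₁ = D'.π₁ ≫ s ∧ m ≫ D.π₂ = D'.π₂ ∧ m ≫ D.ev = D'.ev) := by
    refine and_congr_right fun hs => ⟨fun h => ?_, ?_⟩
    · have hw : (terminal.from R ≫ s) ≫ D.φ = ξ ≫ f := by
        rw [Category.assoc, hs]
        exact D'.isPullback.w
      refine ⟨D.isPullback.lift (terminal.from R ≫ s) ξ hw, by simp [D'], by simp [D'],
        element_ext fun (a : Element R) => ?_⟩
      obtain ⟨t, ht₁, ht₂, ht⟩ := (h (a ≫ ξ) (a ≫ υ)).2 ⟨a, rfl, rfl⟩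
      have : a ≫ D.isPullback.lift (terminal.from R ≫ s) ξ hw = t :=
        D.isPullback.hom_ext (by simp [ht₁, terminal_from_self_comp]) (by simp [ht₂])
      rw [reassoc_of% this, ht]
    · rintro ⟨m, hm₁, hm₂, hm⟩ x y
      have hms (a : Element R) : (a ≫ m) ≫ D.π₁ = s := by
        rw [Category.assoc, hm₁]
        simp [D', terminal_from_self_comp]
      have hm₂' (a : Element R) : (a ≫ m) ≫ D.π₂ = a ≫ ξ := by rw [Category.assoc, hm₂]
      have hm' (a : Element R) : (a ≫ m) ≫ D.ev = a ≫ υ := by rw [Category.assoc, hm]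
      constructor
      · rintro ⟨t, rfl, rfl, rfl⟩
        obtain ⟨_, a, ha, -⟩ := hb (t ≫ D.π₂) (by
          rw [Category.assoc, ← D.isPullback.w, ← Category.assoc, hs])
        have : a ≫ m = t := D.isPullback.hom_ext (hms a) ((hm₂' a).trans ha)
        exact ⟨a, ha, by rw [← hm', this]⟩
      · rintro ⟨a, rfl, rfl⟩
        exact ⟨a ≫ m, hms a, hm₂' a, hm' a⟩
  simp only [hgraph]
  exact hD D'

theorem IsProjective.isChoiceObject {P : C} (hP : IsProjective P) : IsChoiceObject P :=
  fun _ f hf => hP f ((isCover_iff_onto f).2 hf) (𝟙 P)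

end Elementwise

/-! ### From pretopos structure to elementwise axioms -/

section Pretopos

variable {C : Type u} [Category.{v} C]

/-- If `e` factors through a mono `k`, minimality of the image compares `m` with `k ≫ m` and splits
`k`. -/
theorem IsImageFactorization.isCover {A I B : C} {f : A ⟶ B} {e : A ⟶ I} {m : I ⟶ B}
    (h : IsImageFactorization f e m) : IsCover e := by
  obtain ⟨hm, rfl, h⟩ := h
  rintro M g k hk rfl
  obtain ⟨t, ht⟩ := h g (k ≫ m) (mono_comp k m) (by simp)
  have htk : t ≫ k = 𝟙 I := by rw [← cancel_mono m, Category.assoc, ht, Category.id_comp]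
  exact ⟨t, by rw [← cancel_mono k, Category.assoc, htk, Category.comp_id, Category.id_comp], htk⟩

theorem RegularCategory.wellPointedRegular [RegularCategory C] (hp : IsProjective (⊤_ C))
    (hg : TerminalGenerates C) : WellPointedRegular C where
  generation := hg
  factorization A B f := by
    obtain ⟨I, e, m, h⟩ := RegularCategory.exists_image f
    exact ⟨I, e, m, fun y => hp e h.isCover y, h.1, h.2.1⟩

theorem isEmpty_element_initial [FinitaryExtensive C] [HasTerminal C]
    (h : IsEmpty (⊥_ C ≅ ⊤_ C)) : IsEmpty (Element (⊥_ C)) := by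
  refine ⟨fun x => h.elim ?_⟩
  have : IsIso x := HasStrictInitialObjects.out x initialIsInitial
  exact (asIso x).symm

/-- Sums are disjoint, so equal injections would yield a map from `1` to their pullback `0`. -/
theorem ne_of_isColimit [FinitaryExtensive C] [HasTerminal C]
    (h : IsEmpty (⊥_ C ≅ ⊤_ C)) {S : C} (x y : Element S)
    (hc : IsColimit (BinaryCofan.mk x y)) : x ≠ y := by
  rintro rfl
  have hp := FinitaryExtensive.isPullback_initial_to_binaryCofan hc
  have hl : ⊤_ C ⟶ ⊥_ C := hp.lift (𝟙 _) (𝟙 _) rfl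
  exact (isEmpty_element_initial h).elim hl

theorem CETCS.of_pretopos [LocallyCartesianClosed C] [Pretopos C] (hN : HasNNO C)
    (hp : IsProjective (⊤_ C)) (hg : TerminalGenerates C) (h01 : IsEmpty (⊥_ C ≅ ⊤_ C))
    (hd : DisjunctionProperty C) (he : HasEnoughProjectives C) : CETCS C := by
  have := RegularCategory.wellPointedRegular hp hg
  have hpi : HasElementwisePi C := ⟨fun Y X I g f => by
    obtain ⟨D, hD⟩ := LocallyCartesianClosed.exists_universal g f
    exact ⟨D, hD.isUniversalOnElements⟩⟩
  have heff ⦃R X : C⦄ (r₁ r₂ : R ⟶ X) (hr : IsEquivalenceRelation r₁ r₂) :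
      ∃ (E : C) (e : X ⟶ E), ∀ x₁ x₂ : Element X, Mem₂ x₁ x₂ r₁ r₂ ↔ x₁ ≫ e = x₂ ≫ e := by
    obtain ⟨E, e, hE⟩ := Pretopos.effective r₁ r₂ hr
    exact ⟨E, e, IsKernelPair.mem₂_iff hE⟩
  have := hasCoequalizers_of_effective hN heff
  exact
    { dependentProducts := hpi.exists_pi
      naturalNumbers := hN
      generation := hg
      presentation := fun A => by
        obtain ⟨P, p, hP, hp⟩ := he A
        exact ⟨P, p, hP.isChoiceObject, (isCover_iff_onto p).1 hp⟩
      initial_no_elements := isEmpty_element_initial h01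
      disjunction := hd
      nontriviality := fun S x y ⟨hc⟩ => ne_of_isColimit h01 x y hc
      factorization := WellPointedRegular.factorization
      effectiveness := heff }

end Pretopos

end ConstructiveSets

open ConstructiveSets

theorem mainTheorem1 (C : Type u) [Category.{v} C] :
    CETCS C ↔
      ∃ (_ : LocallyCartesianClosed C) (_ : Pretopos C),
        HasNNO C ∧
        (IsProjective (⊤_ C) ∧ TerminalGenerates C) ∧
        IsEmpty (⊥_ C ≅ ⊤_ C) ∧
        DisjunctionProperty C ∧
        HasEnoughProjectives C := by
  constructor
  · intro h
    have := h.locallyCartesianClosed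
    have := h.pretopos
    have := h.wellPointedRegular
    refine ⟨inferInstance, inferInstance, h.naturalNumbers,
      ⟨isProjective_terminal, h.generation⟩, ⟨fun i => h.initial_no_elements.elim i.inv⟩,
      h.disjunction, fun A => ?_⟩
    obtain ⟨P, p, hP, hp⟩ := h.presentation A
    exact ⟨P, p, hP.isProjective, (isCover_iff_onto p).2 hp⟩
  · rintro ⟨_, _, hN, ⟨hp, hg⟩, h01, hd, he⟩
    exact CETCS.of_pretopos hN hp hg h01 hd he
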